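/- Let $\mathbb{F}_q$ be a finite field, $\mathcal{M}$ the set of monic polynomials in $\mathbb{F}_q[T]$, and $\mathcal{M}_n$ those of degree $n$. A polynomial is called squareful if it is not squarefree. Let $\mu$ be the Möbius function on $\mathcal{M}$ ($\mu(g)=(-1)^\ell$ if $g$ is a product of $\ell$ distinct monic irreducibles, $\mu(g)=0$ if $g$ is squareful), let $\Lambda(g)=\deg P$ if $g=P^k$ with $P$ monic irreducible and $k\ge 1$, and $\Lambda(g)=0$ otherwise, and for $j\ge 1$ let $$\Lambda_j(f)=\sum_{g\mid f,\ g\ \mathrm{monic}}\mu(g)\,\deg(f/g)^j .$$ For a partition $\lambda\vdash n$ let $X^\lambda$ be the irreducible complex character of the symmetric group $\mathfrak{S}_n$ indexed by $\lambda$ (the character of the Specht module; $X^{(n)}$ is the trivial character), and write $X^\lambda(\tau)$ for its value at permutations of cycle type $\tau$. For $f\in\mathcal{M}$ put $X^\lambda(f)=X^\lambda(\tau_f)$ if $f$ is squarefree of degree $n$, where $\tau_f\vdash n$ is the partition formed by the degrees of the irreducible factors of $f$, and $X^\lambda(f)=0$ otherwise. 1. For all integers $r\ge 1$ and $s\ge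 0$ there is a function $b:\mathcal{M}\to\mathbb{C}$ supported on the squarefuls such that for every $f\in\mathcal{M}_{r+s}$, $$\sum_{\substack{g\mid f,\ g\ \mathrm{monic}\\ \deg g\le s}}\mu(g)=(-1)^s X^{(r,1^s)}(f)+b(f).$$ 2. For every integer $j\ge 1$ there is a function $b:\mathcal{M}\to\mathbb{C}$ supported on the squarefuls such that for every $n\ge 0$ and $f\in\mathcal{M}_n$, $$\Lambda_j(f)=\sum_{r=1}^n(-1)^{n-r}\bigl(r^j-(r-1)^j\bigr)X^{(r,1^{n-r})}(f)+b(f).$$ 3. In particular, there is a function $b:\mathcal{M}\to\mathbb{C}$ supported on the squarefuls such that for every $n\ge 0$ and $f\in\mathcal{M}_n$, $$\Lambda(f)=\sum_{r=1}^n(-1)^{n-r}X^{(r,1^{n-r})}(f)+b(f).$$ -/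

import Mathlib

open Polynomial

noncomputable section

/-! ### Irreducible characters of the symmetric group -/

/-- The Young diagram of a partition `λ = (λ₁ ≥ λ₂ ≥ ⋯)`: its `i`-th row has `λᵢ` boxes. -/
def youngDiagramOf {n : ℕ} (lam : n.Partition) : YoungDiagram :=
  YoungDiagram.ofRowLens (lam.parts.sort (· ≥ ·)) (Multiset.pairwise_sort _ _).sortedGE

/-- The `n` boxes of the Young diagram of `λ ⊢ n`. We take these boxes themselves as the `n`
letters permuted by the symmetric group `𝔖ₙ`, so that the Young tableau used in the construction
of the Young symmetrizer is the tautological one. -/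
abbrev Box {n : ℕ} (lam : n.Partition) : Type := {c : ℕ × ℕ // c ∈ (youngDiagramOf lam).cells}

theorem card_box {n : ℕ} (lam : n.Partition) : Fintype.card (Box lam) = n := by
  have key : ∀ w : List ℕ, (YoungDiagram.cellsOfRowLens w).card = w.sum := by
    intro w
    induction w with
    | nil => simp [YoungDiagram.cellsOfRowLens]
    | cons a w ih =>
      rw [YoungDiagram.cellsOfRowLens, Finset.card_union_of_disjoint]
      · simp [ih]
      · rw [Finset.disjoint_left]
        rintro ⟨i, k⟩ h1 h2
        simp at h1 h2
        omega
  rw [Fintype.card_coe]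
  have h := key (lam.parts.sort (· ≥ ·))
  rw [← Multiset.sum_coe, Multiset.sort_eq, lam.parts_sum] at h
  exact h

/-- The group algebra `ℂ[𝔖ₙ]`. -/
abbrev SymGroupAlgebra {n : ℕ} (lam : n.Partition) : Type := MonoidAlgebra ℂ (Equiv.Perm (Box lam))

open Classical in
/-- The row symmetrizer `a_λ`: the sum of all permutations preserving every row. -/
def rowSymmetrizer {n : ℕ} (lam : n.Partition) : SymGroupAlgebra lam :=
  ∑ p : Equiv.Perm (Box lam) with ∀ c, (p c).1.1 = c.1.1, MonoidAlgebra.single p 1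

open Classical in
/-- The column antisymmetrizer `b_λ`: the signed sum of all permutations preserving every
column. -/
def colAntisymmetrizer {n : ℕ} (lam : n.Partition) : SymGroupAlgebra lam :=
  ∑ p : Equiv.Perm (Box lam) with ∀ c, (p c).1.2 = c.1.2,
    MonoidAlgebra.single p ((Equiv.Perm.sign p : ℤ) : ℂ)

/-- The Young symmetrizer `c_λ = a_λ b_λ`. -/
def youngSymmetrizer {n : ℕ} (lam : n.Partition) : SymGroupAlgebra lam :=
  rowSymmetrizer lam * colAntisymmetrizer lam

/-- The Specht module: the left ideal `ℂ[𝔖ₙ] c_λ`. -/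
def spechtModule {n : ℕ} (lam : n.Partition) : Submodule ℂ (SymGroupAlgebra lam) :=
  LinearMap.range (LinearMap.mulRight ℂ (youngSymmetrizer lam))

/-- The irreducible representation of `𝔖ₙ` attached to `λ`: left multiplication on the Specht
module `ℂ[𝔖ₙ] c_λ`. -/
def spechtRep {n : ℕ} (lam : n.Partition) :
    Representation ℂ (Equiv.Perm (Box lam)) (spechtModule lam) where
  toFun σ := (LinearMap.mulLeft ℂ (MonoidAlgebra.single σ (1 : ℂ) : SymGroupAlgebra lam)).restrict (by
    rintro _ ⟨x, rfl⟩
    exact ⟨MonoidAlgebra.single σ (1 : ℂ) * x, by simp [mul_assoc]⟩)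
  map_one' := by
    ext x
    simp [LinearMap.restrict_apply, ← MonoidAlgebra.one_def]
  map_mul' σ τ := by
    ext x
    simp [LinearMap.restrict_apply, ← mul_assoc, MonoidAlgebra.single_mul_single]

/-- The irreducible character `X^λ(σ)` of the symmetric group. -/
def symChar {n : ℕ} (lam : n.Partition) (σ : Equiv.Perm (Box lam)) : ℂ :=
  (spechtRep lam).character σ

open Classical in
/-- `X^λ(τ)`: the value of the character `X^λ` at the permutations of cycle type `τ` (fixed points
are recorded in the cycle type as parts equal to `1`). It is only used when `τ` is a partition
of `n`. -/
def symCharAt {n : ℕ} (lam : n.Partition) (τ : Multiset ℕ) : ℂ :=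
  if h : ∃ σ : Equiv.Perm (Box lam), σ.partition.parts = τ then symChar lam h.choose else 0

/-- The value `X^λ(τ)` does not depend on the permutation of cycle type `τ`. -/
theorem symCharAt_partition {n : ℕ} (lam : n.Partition) (σ : Equiv.Perm (Box lam)) :
    symCharAt lam σ.partition.parts = symChar lam σ := by
  have h : ∃ σ' : Equiv.Perm (Box lam), σ'.partition.parts = σ.partition.parts := ⟨σ, rfl⟩
  have hc : IsConj σ h.choose :=
    Equiv.Perm.partition_eq_of_isConj.2 (Nat.Partition.ext h.choose_spec.symm)
  obtain ⟨c, hc⟩ := isConj_iff.1 hc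
  rw [symCharAt, dif_pos h, ← hc]
  exact Representation.char_conj _ _ _

/-- Every partition of `n` is the cycle type of some permutation. -/
theorem exists_perm_partition {n : ℕ} (lam τ : n.Partition) :
    ∃ σ : Equiv.Perm (Box lam), σ.partition.parts = τ.parts := by
  have hs := τ.parts_sum
  rw [← Multiset.filter_add_not (fun k => 2 ≤ k) τ.parts, Multiset.sum_add] at hs
  have h1 : τ.parts.filter (fun k => ¬ 2 ≤ k) =
      Multiset.replicate (τ.parts.filter (fun k => ¬ 2 ≤ k)).card 1 := by
    refine Multiset.eq_replicate_card.2 fun b hb => ?_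
    have h2 := Multiset.mem_filter.1 hb
    have h3 := τ.parts_pos h2.1
    omega
  have h2 : (τ.parts.filter (fun k => ¬ 2 ≤ k)).sum =
      (τ.parts.filter (fun k => ¬ 2 ≤ k)).card := by
    conv_lhs => rw [h1]
    simp
  obtain ⟨σ, hσ⟩ := (Equiv.Perm.exists_with_cycleType_iff (Box lam)
    (m := τ.parts.filter (fun k => 2 ≤ k))).2
    ⟨by rw [card_box]; omega, fun a ha => (Multiset.mem_filter.1 ha).2⟩
  refine ⟨σ, ?_⟩
  rw [Equiv.Perm.parts_partition, ← Equiv.Perm.sum_cycleType, hσ, card_box]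
  conv_rhs => rw [← Multiset.filter_add_not (fun k => 2 ≤ k) τ.parts, h1]
  congr 2
  omega

/-- The hook partition `(r, 1^s)` of `r + s` (used only for `r ≥ 1`). -/
def hook (r s : ℕ) : (r + s).Partition :=
  Nat.Partition.ofSums (r + s) (r ::ₘ Multiset.replicate s 1) (by simp)

/-! ### Arithmetic functions on polynomials over a field -/

variable {F : Type*} [Field F]

open Classical in
/-- The multiset of degrees of the prime factors of `f`. For squarefree `f` of degree `n`
this is the factorization type of `f`, a partition of `n`. -/
def factorizationType (f : F[X]) : Multiset ℕ :=
  (UniqueFactorizationMonoid.normalizedFactors f).map natDegree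

open Classical in
/-- `X^λ(f)` for `λ ⊢ n`: equal to `X^λ(τ_f)` if `deg f = n` and `f` is squarefree, and to `0`
otherwise. -/
def polyChar {n : ℕ} (lam : n.Partition) (f : F[X]) : ℂ :=
  if f.natDegree = n ∧ Squarefree f then symCharAt lam (factorizationType f) else 0

open Classical in
/-- The Möbius function on `F[X]`. -/
def moebius (g : F[X]) : ℂ :=
  if Squarefree g then (-1) ^ (UniqueFactorizationMonoid.normalizedFactors g).card else 0

open Classical in
/-- The von Mangoldt function: `Λ(P ^ k) = deg P` for `P` a monic prime and `k ≥ 1`, and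
`Λ(g) = 0` if `g` is not of this form. -/
def vonMangoldt (g : F[X]) : ℂ :=
  if h : ∃ P : F[X], P.Monic ∧ Irreducible P ∧ ∃ k : ℕ, 1 ≤ k ∧ g = P ^ k then
    (h.choose.natDegree : ℂ) else 0

theorem vonMangoldt_pow (P : F[X]) (hm : P.Monic) (hP : Irreducible P) (k : ℕ) (hk : 1 ≤ k) :
    vonMangoldt (P ^ k) = P.natDegree := by
  have h : ∃ Q : F[X], Q.Monic ∧ Irreducible Q ∧ ∃ l : ℕ, 1 ≤ l ∧ P ^ k = Q ^ l :=
    ⟨P, hm, hP, k, hk, rfl⟩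
  obtain ⟨hQm, hQ, l, hl, e⟩ := h.choose_spec
  have hdvd : P ∣ h.choose ^ l := e ▸ dvd_pow_self P (by omega)
  have := eq_of_monic_of_associated hm hQm (hP.associated_of_dvd hQ (hP.prime.dvd_of_dvd_pow hdvd))
  rw [vonMangoldt, dif_pos h, ← this]

/-- A nonzero polynomial has only finitely many monic divisors. -/
theorem finite_monic_divisors (f : F[X]) (hf : f ≠ 0) : {g : F[X] | g.Monic ∧ g ∣ f}.Finite := by
  have : Finite {g : F[X] // g.Monic ∧ g ∣ f} := (fintypeSubtypeMonicDvd f hf).finite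
  exact Set.finite_coe_iff.1 this

/-- `∑ μ(g)` over the monic divisors `g` of `f` of degree at most `s`. -/
def truncMoebiusSum (s : ℕ) (f : F[X]) : ℂ :=
  ∑ᶠ g ∈ {g : F[X] | g.Monic ∧ g ∣ f ∧ g.natDegree ≤ s}, moebius g

/-- The higher von Mangoldt function `Λ_j(f) = ∑ μ(g) deg(f / g) ^ j`, over the monic divisors `g`
of `f`. -/
def higherVonMangoldt (j : ℕ) (f : F[X]) : ℂ :=
  ∑ᶠ g ∈ {g : F[X] | g.Monic ∧ g ∣ f}, moebius g * ((f / g).natDegree : ℂ) ^ j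

/-- A function on the monic polynomials that is supported on the squarefuls, i.e. on the
polynomials that are not squarefree. -/
def SupportedOnSquareful (b : F[X] → ℂ) : Prop :=
  ∀ f : F[X], f.Monic → Squarefree f → b f = 0

end

/-! Both sides are read off from one polynomial. For a multiset `τ` of degrees let `G = ∏ (1 - X ^
d)` over `d ∈ τ`. If `f` is monic and squarefree, its monic divisors are the products of subsets of
its prime factors, so expanding `G` for `τ = factorizationType f` shows that its coefficient at `X ^
t` is the sum of `μ(g)` over the monic divisors of degree `t` (`finsum_moebius_mul`). The truncated
sum is then a partial sum of coefficients, and `Λ_j(f)` is `∑ coeff t * (n - t) ^ j`.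

On the character side, `symChar_hook` shows that `X^(r,1^s)` at cycle type `τ` is `(-1) ^ s` times
the same partial sum. Classically: the trace on the `k`-th exterior power of the permutation
representation is `(-1) ^ k` times the coefficient of `G` at `X ^ k`, and for `0 < k < n` this power
is the sum of the hooks with legs `k` and `k - 1`, because the Koszul complex splits; solving for
the hooks gives alternating partial sums.

The argument runs inside the group algebra. The idempotent `extIdem C` generates the exterior power,
and for a suitable `C` the Young symmetrizer of a hook is a multiple of `extIdem C * extIdem (insert
c C)`. The Koszul homotopy becomes `extIdem_homotopy`, which yields both the quasi-idempotence of
the symmetrizer and, through `twistedTrace`, the recursion for the characters. The exterior power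
traces come from summing over subsets of the cycles (`sum_cutWeight_mul_pow`).

Part 2 follows by Abel summation against `r ^ j`. Part 3 is the case `j = 1`, where the sum is `n *
G(1) - G'(1)` and this detects whether `G` has exactly one factor. -/

set_option linter.unusedSectionVars false

noncomputable section

/-! ### Partial symmetrizers in the group algebra of a symmetric group -/

section Symmetrizers

open MonoidAlgebra Equiv

variable {X : Type*} [Fintype X] [DecidableEq X]

/-- The sign character with complex values. -/
def signChar : Perm X →* ℂ :=
  ((Int.castRingHom ℂ).toMonoidHom.comp (Units.coeHom ℤ)).comp Perm.sign

theorem signChar_apply (p : Perm X) : signChar p = ((Perm.sign p : ℤ) : ℂ) := rfl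

theorem signChar_swap {x y : X} (h : x ≠ y) : signChar (swap x y) = -1 := by
  simp [signChar_apply, Perm.sign_swap h]

theorem mem_permsOfFinset {S : Finset X} {p : Perm X} :
    p ∈ permsOfFinset S ↔ ∀ x, x ∉ S → p x = x := by
  rw [mem_perms_of_finset_iff]
  exact ⟨fun h x hx => by_contra fun h' => hx (h h'), fun h x hx => by_contra fun h' => hx (h x h')⟩

theorem mul_mem_permsOfFinset {S : Finset X} {p q : Perm X} (hp : p ∈ permsOfFinset S)
    (hq : q ∈ permsOfFinset S) : p * q ∈ permsOfFinset S := by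
  rw [mem_permsOfFinset] at *
  intro x hx
  rw [Perm.mul_apply, hq x hx, hp x hx]

theorem inv_mem_permsOfFinset {S : Finset X} {p : Perm X} (hp : p ∈ permsOfFinset S) :
    p⁻¹ ∈ permsOfFinset S := by
  rw [mem_permsOfFinset] at *
  intro x hx
  rw [Perm.inv_eq_iff_eq, hp x hx]

theorem permsOfFinset_mono {S S' : Finset X} (h : S ⊆ S') : permsOfFinset S ⊆ permsOfFinset S' := by
  intro p hp
  rw [mem_permsOfFinset] at *
  exact fun x hx => hp x fun hx' => hx (h hx')

theorem swap_mem_permsOfFinset {S : Finset X} {x y : X} (hx : x ∈ S) (hy : y ∈ S) :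
    swap x y ∈ permsOfFinset S := by
  rw [mem_permsOfFinset]
  intro z hz
  exact swap_apply_of_ne_of_ne (fun h => hz (h ▸ hx)) (fun h => hz (h ▸ hy))

/-- The average of `ε p • p` over the permutations `p` supported in `S`. -/
def symAvg (ε : Perm X →* ℂ) (S : Finset X) : MonoidAlgebra ℂ (Perm X) :=
  ((S.card.factorial : ℂ)⁻¹) • ∑ p ∈ permsOfFinset S, single p (ε p)

theorem single_mul_symAvg (ε : Perm X →* ℂ) {S : Finset X} {p : Perm X}
    (hp : p ∈ permsOfFinset S) : single p (ε p) * symAvg ε S = symAvg ε S := by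
  rw [symAvg, mul_smul_comm, Finset.mul_sum]
  congr 1
  refine Finset.sum_bij' (fun q _ => p * q) (fun q _ => p⁻¹ * q)
    (fun q hq => mul_mem_permsOfFinset hp hq)
    (fun q hq => mul_mem_permsOfFinset (inv_mem_permsOfFinset hp) hq) (by simp) (by simp) ?_
  intro q _
  rw [single_mul_single, map_mul]

theorem symAvg_mul_single (ε : Perm X →* ℂ) {S : Finset X} {p : Perm X}
    (hp : p ∈ permsOfFinset S) : symAvg ε S * single p (ε p) = symAvg ε S := by
  rw [symAvg, smul_mul_assoc, Finset.sum_mul]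
  congr 1
  refine Finset.sum_bij' (fun q _ => q * p) (fun q _ => q * p⁻¹)
    (fun q hq => mul_mem_permsOfFinset hq hp)
    (fun q hq => mul_mem_permsOfFinset hq (inv_mem_permsOfFinset hp)) (by simp) (by simp) ?_
  intro q _
  rw [single_mul_single, map_mul]

theorem symAvg_mul_of_subset (ε : Perm X →* ℂ) {S S' : Finset X} (h : S ⊆ S') :
    symAvg ε S * symAvg ε S' = symAvg ε S' := by
  rw [symAvg, smul_mul_assoc, Finset.sum_mul,
    Finset.sum_congr rfl fun p hp => single_mul_symAvg ε (permsOfFinset_mono h hp),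
    Finset.sum_const, card_perms_of_finset, ← Nat.cast_smul_eq_nsmul ℂ, smul_smul,
    inv_mul_cancel₀ (Nat.cast_ne_zero.2 (Nat.factorial_ne_zero _)), one_smul]

theorem symAvg_mul_of_superset (ε : Perm X →* ℂ) {S S' : Finset X} (h : S ⊆ S') :
    symAvg ε S' * symAvg ε S = symAvg ε S' := by
  rw [symAvg.eq_1 ε S, mul_smul_comm, Finset.mul_sum,
    Finset.sum_congr rfl fun p hp => symAvg_mul_single ε (permsOfFinset_mono h hp),
    Finset.sum_const, card_perms_of_finset, ← Nat.cast_smul_eq_nsmul ℂ, smul_smul,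
    inv_mul_cancel₀ (Nat.cast_ne_zero.2 (Nat.factorial_ne_zero _)), one_smul]

theorem disjoint_of_mem_permsOfFinset {S D : Finset X} (h : Disjoint S D) {p q : Perm X}
    (hp : p ∈ permsOfFinset S) (hq : q ∈ permsOfFinset D) : p.Disjoint q := by
  rw [mem_permsOfFinset] at hp hq
  intro x
  by_cases hx : x ∈ S
  · exact Or.inr (hq x (Finset.disjoint_left.1 h hx))
  · exact Or.inl (hp x hx)

theorem symAvg_commute (ε δ : Perm X →* ℂ) {S D : Finset X} (h : Disjoint S D) :
    symAvg ε S * symAvg δ D = symAvg δ D * symAvg ε S := by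
  simp only [symAvg, smul_mul_smul_comm, Finset.sum_mul_sum]
  rw [mul_comm, Finset.sum_comm]
  congr 1
  refine Finset.sum_congr rfl fun q hq => Finset.sum_congr rfl fun p hp => ?_
  rw [single_mul_single, single_mul_single, mul_comm (ε p),
    (disjoint_of_mem_permsOfFinset h hp hq).commute.eq]

/-- Coset decomposition: a permutation `p` supported in `insert c S` factors uniquely as one
supported in `S` times `swap c x`, with `x = p⁻¹ c`. The coset `x = c` gives the summand `1`. -/
theorem symAvg_insert (ε : Perm X →* ℂ) {S : Finset X} {c : X} (hc : c ∉ S) :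
    ((S.card : ℂ) + 1) • symAvg ε (insert c S) =
      symAvg ε S * (1 + ∑ x ∈ S, single (swap c x) (ε (swap c x))) := by
  have key : ∑ p ∈ permsOfFinset (insert c S), single p (ε p) =
      (∑ p ∈ permsOfFinset S, single p (ε p)) * ∑ x ∈ insert c S, single (swap c x) (ε (swap c x)) := by
    rw [Finset.sum_mul_sum, ← Finset.sum_product']
    symm
    refine Finset.sum_bij' (fun z _ => z.1 * swap c z.2)
      (fun p _ => (p * swap c (p⁻¹ c), p⁻¹ c)) ?_ ?_ ?_ ?_ ?_
    · rintro ⟨p, x⟩ h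
      rw [Finset.mem_product] at h
      exact mul_mem_permsOfFinset (permsOfFinset_mono (Finset.subset_insert _ _) h.1)
        (swap_mem_permsOfFinset (Finset.mem_insert_self _ _) h.2)
    · intro p hp
      have hx : p⁻¹ c ∈ insert c S := by
        by_contra h
        have := mem_permsOfFinset.1 hp _ h
        have hcp : c = p⁻¹ c := by simpa using this
        exact h (hcp ▸ Finset.mem_insert_self _ _)
      have h := mem_permsOfFinset.1 (mul_mem_permsOfFinset hp
        (swap_mem_permsOfFinset (Finset.mem_insert_self c S) hx))
      refine Finset.mem_product.2 ⟨mem_permsOfFinset.2 fun y hy => ?_, hx⟩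
      by_cases hyc : y = c
      · subst hyc
        simp
      · exact h y (by simp [hyc, hy])
    · rintro ⟨p, x⟩ h
      rw [Finset.mem_product] at h
      have hpc : p⁻¹ c = c := mem_permsOfFinset.1 (inv_mem_permsOfFinset h.1) c hc
      have hpx : (p * swap c x)⁻¹ c = x := by
        rw [mul_inv_rev, swap_inv, Perm.mul_apply, hpc, swap_apply_left]
      simp only [hpx, mul_assoc, swap_mul_self, mul_one]
    · intro p _
      simp [mul_assoc]
    · rintro ⟨p, x⟩ _
      rw [single_mul_single, map_mul]
  rw [symAvg, key, Finset.sum_insert hc, swap_self, Finset.card_insert_of_notMem hc, symAvg,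
    smul_smul, smul_mul_assoc]
  have h1 : single (Equiv.refl X : Perm X) (ε (Equiv.refl X)) = (1 : MonoidAlgebra ℂ (Perm X)) := by
    rw [show (Equiv.refl X : Perm X) = 1 from rfl, map_one, MonoidAlgebra.one_def]
  rw [h1]
  congr 1
  have h2 : (S.card.factorial : ℂ) ≠ 0 := Nat.cast_ne_zero.2 (Nat.factorial_ne_zero _)
  have h3 : (S.card : ℂ) + 1 ≠ 0 := Nat.cast_add_one_ne_zero _
  rw [Nat.factorial_succ]
  push_cast
  field_simp

/-- Both factors absorb `p`, but with opposite signs, so the product equals its own negative. -/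
theorem symAvg_mul_symAvg_eq_zero {ε δ : Perm X →* ℂ} {S S' : Finset X} {p : Perm X}
    (hp : p ∈ permsOfFinset S) (hp' : p ∈ permsOfFinset S') (h : ε p = -δ p) :
    symAvg ε S * symAvg δ S' = 0 := by
  have h1 : symAvg ε S * symAvg δ S' = -(symAvg ε S * symAvg δ S') := by
    conv_lhs => rw [← symAvg_mul_single ε hp, mul_assoc, h, single_neg, neg_mul, mul_neg,
      single_mul_symAvg δ hp']
  have h2 : (2 : ℂ) • (symAvg ε S * symAvg δ S') = 0 := by
    rw [two_smul]
    nth_rewrite 1 [h1]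
    exact neg_add_cancel _
  exact (smul_eq_zero.1 h2).resolve_left two_ne_zero

/-- The idempotent of `ℂ[𝔖_X]` generating the `|C|`-th exterior power of the permutation
representation. -/
def extIdem (C : Finset X) : MonoidAlgebra ℂ (Perm X) := symAvg signChar C * symAvg 1 Cᶜ

theorem extIdem_comm (C : Finset X) : symAvg signChar C * symAvg 1 Cᶜ = symAvg 1 Cᶜ * symAvg signChar C :=
  symAvg_commute _ _ disjoint_compl_right

theorem extIdem_mul_self (C : Finset X) : extIdem C * extIdem C = extIdem C := by
  rw [extIdem]
  nth_rewrite 1 [extIdem_comm]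
  rw [mul_assoc, ← mul_assoc (symAvg signChar C), symAvg_mul_of_subset _ subset_rfl, extIdem_comm,
    ← mul_assoc, symAvg_mul_of_subset _ subset_rfl]

theorem extIdem_mul_single_of_mem {C : Finset X} {p : Perm X} (hp : p ∈ permsOfFinset C) :
    extIdem C * single p (signChar p) = extIdem C := by
  rw [extIdem, extIdem_comm, mul_assoc, symAvg_mul_single _ hp]

theorem single_mul_extIdem_of_mem {C : Finset X} {p : Perm X} (hp : p ∈ permsOfFinset C) :
    single p (signChar p) * extIdem C = extIdem C := by
  rw [extIdem, ← mul_assoc, single_mul_symAvg _ hp]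

theorem extIdem_mul_single_of_mem_compl {C : Finset X} {p : Perm X} (hp : p ∈ permsOfFinset Cᶜ) :
    extIdem C * single p 1 = extIdem C := by
  rw [extIdem, mul_assoc]
  congr 1
  exact symAvg_mul_single 1 hp

theorem single_mul_extIdem_of_mem_compl {C : Finset X} {p : Perm X} (hp : p ∈ permsOfFinset Cᶜ) :
    single p 1 * extIdem C = extIdem C := by
  rw [extIdem, extIdem_comm, ← mul_assoc]
  congr 1
  exact single_mul_symAvg 1 hp

/-- Transpositions crossing the boundary of `C` are conjugate under permutations preserving `C`. The
outer factors absorb the conjugating element; the sign of `swap x y` occurs on both sides and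
cancels. -/
theorem extIdem_swap_extIdem {C : Finset X} {x y c d : X} (hx : x ∈ C) (hy : y ∈ C) (hc : c ∉ C)
    (hd : d ∉ C) : extIdem C * single (swap c x) 1 * extIdem C =
      extIdem C * single (swap d y) 1 * extIdem C := by
  have key : (swap x y * swap c d) * swap c x * (swap c d * swap x y) = swap d y := by
    have h : swap ((swap x y * swap c d) c) ((swap x y * swap c d) x) =
        (swap x y * swap c d) * swap c x * (swap x y * swap c d)⁻¹ := swap_apply_apply _ _ _
    have hxc : x ≠ c := fun h => hc (h ▸ hx)
    have hxd : x ≠ d := fun h => hd (h ▸ hx)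
    have hyd : y ≠ d := fun h => hd (h ▸ hy)
    rw [mul_inv_rev, swap_inv, swap_inv] at h
    rw [← h]
    simp [swap_apply_of_ne_of_ne hxc hxd, swap_apply_of_ne_of_ne hxd.symm hyd.symm]
  have e : (1 : ℂ) = signChar (swap x y) * 1 * (1 * 1 * 1) * signChar (swap x y) := by
    rcases eq_or_ne x y with rfl | h
    · rw [swap_self, show (Equiv.refl X : Perm X) = 1 from rfl, map_one]; norm_num
    · rw [signChar_swap h]; norm_num
  have h1 := swap_mem_permsOfFinset hx hy
  have h2 : swap c d ∈ permsOfFinset Cᶜ := swap_mem_permsOfFinset (by simpa) (by simpa)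
  rw [← key]
  have hs : single (swap x y * swap c d * swap c x * (swap c d * swap x y)) (1 : ℂ) =
      single (swap x y) (signChar (swap x y)) * (single (swap c d) 1 * single (swap c x) 1 *
        single (swap c d) 1) * single (swap x y) (signChar (swap x y)) := by
    simp only [single_mul_single, mul_assoc]
    congr 1
    linear_combination e
  rw [hs]
  simp only [← mul_assoc]
  rw [extIdem_mul_single_of_mem h1, extIdem_mul_single_of_mem_compl h2]
  simp only [mul_assoc]
  rw [single_mul_extIdem_of_mem h1, single_mul_extIdem_of_mem_compl h2]

/-- Going up by the element `c`, only the sign symmetrizer of the larger set matters. -/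
theorem extIdem_mul_extIdem_insert {C : Finset X} (c : X) :
    extIdem C * extIdem (insert c C) =
      symAvg 1 Cᶜ * symAvg signChar (insert c C) * symAvg 1 (insert c C)ᶜ := by
  rw [extIdem, extIdem, extIdem_comm C, mul_assoc, ← mul_assoc (symAvg signChar C),
    symAvg_mul_of_subset _ (Finset.subset_insert c C), mul_assoc]

/-- The last symmetrizer is swallowed by that of the larger set `Cᶜ`. The result is a normalized
Young symmetrizer of a hook whose first row is `Cᶜ` and whose first column is `insert c C`. -/
theorem extIdem_mul_extIdem_insert_eq {C : Finset X} (c : X) :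
    extIdem C * extIdem (insert c C) = symAvg 1 Cᶜ * symAvg signChar (insert c C) := by
  rw [extIdem_mul_extIdem_insert, mul_assoc, extIdem_comm, ← mul_assoc,
    symAvg_mul_of_superset _ (Finset.compl_subset_compl.2 (Finset.subset_insert c C))]

/-- The middle factor reduces to a sign symmetrizer on `insert c C`, which `symAvg_insert` expands
into transpositions, each of sign `-1`. The next lemma is the mirror image for the trivial
character, hence with a plus sign. -/
theorem extIdem_mul_extIdem_insert_mul {C : Finset X} {c : X} (hc : c ∉ C) :
    ((C.card : ℂ) + 1) • (extIdem C * extIdem (insert c C) * extIdem C) =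
      extIdem C - ∑ x ∈ C, extIdem C * single (swap c x) 1 * extIdem C := by
  have h1 : extIdem C * extIdem (insert c C) * extIdem C =
      extIdem C * symAvg signChar (insert c C) * extIdem C := by
    rw [extIdem_mul_extIdem_insert_eq, extIdem, extIdem_comm, mul_assoc (symAvg 1 Cᶜ) (symAvg signChar C),
      symAvg_mul_of_subset _ (Finset.subset_insert c C)]
  rw [h1, ← smul_mul_assoc, ← mul_smul_comm, symAvg_insert _ hc, ← mul_assoc]
  have h2 : extIdem C * symAvg signChar C = extIdem C := by
    rw [extIdem, extIdem_comm, mul_assoc, symAvg_mul_of_subset _ subset_rfl]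
  rw [h2, mul_add, mul_one, add_mul, extIdem_mul_self, Finset.mul_sum, Finset.sum_mul,
    sub_eq_add_neg, ← Finset.sum_neg_distrib]
  congr 1
  refine Finset.sum_congr rfl fun x hx => ?_
  rw [signChar_swap (ne_of_mem_of_not_mem hx hc).symm, single_neg, mul_neg, neg_mul]

theorem extIdem_insert_mul_extIdem_mul {C : Finset X} {x : X} (hx : x ∉ C) :
    (((insert x C)ᶜ.card : ℂ) + 1) • (extIdem (insert x C) * extIdem C * extIdem (insert x C)) =
      extIdem (insert x C) +
        ∑ c ∈ (insert x C)ᶜ, extIdem (insert x C) * single (swap x c) 1 * extIdem (insert x C) := by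
  set D := (insert x C)ᶜ with hD
  have hxD : x ∉ D := by simp [hD]
  have hins : Cᶜ = insert x D := by
    ext y
    simp only [hD, Finset.mem_compl, Finset.mem_insert]
    by_cases h : y = x
    · simp [h, hx]
    · simp [h]
  have h1 : extIdem (insert x C) * extIdem C * extIdem (insert x C) =
      extIdem (insert x C) * symAvg 1 (insert x D) * extIdem (insert x C) := by
    rw [mul_assoc, extIdem_mul_extIdem_insert_eq, hins, mul_assoc (extIdem _), extIdem, ← hD,
      extIdem_comm, ← hD, ← mul_assoc (symAvg 1 (insert x D)),
      symAvg_mul_of_superset _ (Finset.subset_insert x D)]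
  have h2 : extIdem (insert x C) * symAvg 1 D = extIdem (insert x C) := by
    rw [extIdem, mul_assoc, symAvg_mul_of_subset _ subset_rfl]
  rw [h1, ← smul_mul_assoc, ← mul_smul_comm, symAvg_insert _ hxD, ← mul_assoc, h2, mul_add, mul_one,
    add_mul, extIdem_mul_self, Finset.mul_sum, Finset.sum_mul]
  rfl

/-- The complex `extIdem C → extIdem (insert x C) → extIdem (insert c (insert x C))`. -/
theorem extIdem_mul_mul_eq_zero {C : Finset X} {x c : X} (hx : x ∉ C) (hc : c ∉ insert x C) :
    extIdem C * extIdem (insert x C) * extIdem (insert c (insert x C)) = 0 := by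
  have hxc : x ≠ c := fun h => hc (h ▸ Finset.mem_insert_self _ _)
  have hc' : c ∉ C := fun h => hc (Finset.mem_insert_of_mem h)
  rw [mul_assoc, extIdem_mul_extIdem_insert_eq, extIdem, mul_assoc, ← mul_assoc (symAvg 1 Cᶜ),
    symAvg_mul_of_superset _ (Finset.compl_subset_compl.2 (Finset.subset_insert x C)),
    symAvg_mul_symAvg_eq_zero (p := swap x c), mul_zero]
  · exact swap_mem_permsOfFinset (by simpa) (by simpa)
  · exact swap_mem_permsOfFinset (by simp) (by simp)
  · rw [signChar_swap hxc]; simp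

theorem extIdem_homotopy {C : Finset X} {x c : X} (hx : x ∉ C) (hc : c ∉ insert x C) :
    (Fintype.card X : ℂ) • extIdem (insert x C) =
      (((insert x C).card + 1 : ℂ) * (insert x C)ᶜ.card) •
        (extIdem (insert x C) * extIdem (insert c (insert x C)) * extIdem (insert x C)) +
      (((insert x C)ᶜ.card + 1 : ℂ) * (insert x C).card) •
        (extIdem (insert x C) * extIdem C * extIdem (insert x C)) := by
  have h1 := extIdem_mul_extIdem_insert_mul hc
  have h2 := extIdem_insert_mul_extIdem_mul hx
  have hxC : x ∈ insert x C := Finset.mem_insert_self _ _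
  have e1 : ∑ y ∈ insert x C, extIdem (insert x C) * single (swap c y) 1 * extIdem (insert x C) =
      (insert x C).card • (extIdem (insert x C) * single (swap c x) 1 * extIdem (insert x C)) :=
    Finset.sum_eq_card_nsmul fun y hy => extIdem_swap_extIdem hy hxC hc hc
  have e2 : ∑ d ∈ (insert x C)ᶜ, extIdem (insert x C) * single (swap x d) 1 * extIdem (insert x C) =
      (insert x C)ᶜ.card • (extIdem (insert x C) * single (swap c x) 1 * extIdem (insert x C)) :=
    Finset.sum_eq_card_nsmul fun d hd => by
      rw [swap_comm]
      exact extIdem_swap_extIdem hxC hxC (Finset.mem_compl.1 hd) hc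
  rw [e1] at h1
  rw [e2] at h2
  -- With `A = insert x C`, `h1` carries `-|A|` and `h2` carries `+|Aᶜ|` times the same crossing
  -- term. Weighting them by `|Aᶜ|` and `|A|` cancels it and leaves `|A| + |Aᶜ| = |X|`.
  rw [mul_comm, mul_smul, h1, mul_comm (_ + 1 : ℂ), mul_smul, h2, ← Finset.card_add_card_compl (insert x C),
    ← Nat.cast_smul_eq_nsmul ℂ, ← Nat.cast_smul_eq_nsmul ℂ]
  push_cast
  module

/-- The scalar making `extIdem C * extIdem (insert c C)` an idempotent. -/
theorem hookIdem_mul_self {C : Finset X} {c : X} (hc : c ∉ C) :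
    (((C.card + 1 : ℂ) * Cᶜ.card)) • (extIdem C * extIdem (insert c C) *
      (extIdem C * extIdem (insert c C))) = (Fintype.card X : ℂ) • (extIdem C * extIdem (insert c C)) := by
  rcases C.eq_empty_or_nonempty with rfl | ⟨x, hx⟩
  · have h := extIdem_mul_extIdem_insert_mul hc
    simp only [Finset.card_empty, Nat.cast_zero, zero_add, one_smul, Finset.sum_empty, sub_zero] at h
    rw [← mul_assoc, h]
    simp
  · obtain ⟨C, hx', rfl⟩ : ∃ C' : Finset X, x ∉ C' ∧ C = insert x C' :=
      ⟨C.erase x, Finset.notMem_erase _ _, (Finset.insert_erase hx).symm⟩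
    -- After right multiplication, the downward term of the homotopy contains two consecutive Koszul
    -- maps and vanishes.
    have h := congrArg (· * extIdem (insert c (insert x C))) (extIdem_homotopy hx' hc)
    rw [add_mul, smul_mul_assoc, smul_mul_assoc, smul_mul_assoc] at h
    rw [mul_assoc (extIdem (insert x C)) (extIdem C), mul_assoc (extIdem (insert x C)) (_ * _),
      extIdem_mul_mul_eq_zero hx' hc, mul_zero, smul_zero, add_zero] at h
    rw [h, ← mul_assoc]

end Symmetrizers

/-! ### Traces of two-sided multiplications -/

section TwistedTrace

open MonoidAlgebra Equiv

variable {X : Type*} [Fintype X] [DecidableEq X]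

/-- The trace of `x ↦ σ * x * y` on the group algebra. -/
def twistedTrace (σ : Perm X) : MonoidAlgebra ℂ (Perm X) →ₗ[ℂ] ℂ where
  toFun y := LinearMap.trace ℂ (MonoidAlgebra ℂ (Perm X))
    (LinearMap.mulLeft ℂ (single σ 1) * LinearMap.mulRight ℂ y)
  map_add' y z := by
    rw [← map_add, ← mul_add]
    congr 2
    refine LinearMap.ext fun x => ?_
    simp [mul_add]
  map_smul' c y := by
    rw [RingHom.id_apply, ← map_smul, ← mul_smul_comm]
    congr 2
    refine LinearMap.ext fun x => ?_
    simp

theorem twistedTrace_apply (σ : Perm X) (y : MonoidAlgebra ℂ (Perm X)) :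
    twistedTrace σ y = LinearMap.trace ℂ (MonoidAlgebra ℂ (Perm X))
      (LinearMap.mulLeft ℂ (single σ 1) * LinearMap.mulRight ℂ y) := rfl

/-- Left multiplication by `σ` commutes with right multiplications, so this is cyclicity of the
trace. -/
theorem twistedTrace_mul_comm (σ : Perm X) (y z : MonoidAlgebra ℂ (Perm X)) :
    twistedTrace σ (y * z) = twistedTrace σ (z * y) := by
  have h1 : LinearMap.mulLeft ℂ (single σ 1) * LinearMap.mulRight ℂ (y * z) =
      LinearMap.mulRight ℂ z * (LinearMap.mulLeft ℂ (single σ 1) * LinearMap.mulRight ℂ y) := by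
    refine LinearMap.ext fun x => ?_
    simp [mul_assoc]
  have h2 : LinearMap.mulLeft ℂ (single σ 1) * LinearMap.mulRight ℂ (z * y) =
      (LinearMap.mulLeft ℂ (single σ 1) * LinearMap.mulRight ℂ y) * LinearMap.mulRight ℂ z := by
    refine LinearMap.ext fun x => ?_
    simp [mul_assoc]
  rw [twistedTrace_apply, twistedTrace_apply, h1, h2, LinearMap.trace_mul_comm]

/-- The map permutes the basis up to the factor `a`; the diagonal entries come from the fixed points
`σ * g * h = g`. -/
theorem twistedTrace_single (σ h : Perm X) (a : ℂ) :
    twistedTrace σ (single h a) = ∑ g : Perm X, if g * h * g⁻¹ = σ⁻¹ then a else 0 := by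
  rw [twistedTrace_apply, LinearMap.trace_eq_matrix_trace ℂ (MonoidAlgebra.basis (Perm X) ℂ),
    Matrix.trace]
  refine Finset.sum_congr rfl fun g _ => ?_
  rw [Matrix.diag_apply, LinearMap.toMatrix_apply, Module.End.mul_apply, LinearMap.mulRight_apply,
    LinearMap.mulLeft_apply, MonoidAlgebra.basis_apply, single_mul_single, single_mul_single,
    one_mul, one_mul]
  have h1 : σ * (g * h) = g ↔ g * h * g⁻¹ = σ⁻¹ := by
    rw [mul_inv_eq_iff_eq_mul, eq_inv_mul_iff_mul_eq]
  simp only [← h1]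
  change (single (σ * (g * h)) a : MonoidAlgebra ℂ (Perm X)).coeff g = _
  rw [MonoidAlgebra.coeff_single, Finsupp.single_apply]

/-- The signed number of ways to write `π = p * q` with `p` supported in `S` and `q` supported in
the complement of `S`. It is the sign of the restriction of `π` to `S` if `S` is invariant. -/
def cutWeight (π : Perm X) (S : Finset X) : ℂ :=
  ∑ p ∈ permsOfFinset S, if p⁻¹ * π ∈ permsOfFinset Sᶜ then signChar p else 0

theorem conj_mem_permsOfFinset {S : Finset X} (g : Perm X) {p : Perm X} :
    g * p * g⁻¹ ∈ permsOfFinset (S.map g.toEmbedding) ↔ p ∈ permsOfFinset S := by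
  rw [mem_permsOfFinset, mem_permsOfFinset, ← g.forall_congr_right]
  refine forall_congr' fun x => ?_
  simp

theorem cutWeight_map (π g : Perm X) (S : Finset X) :
    cutWeight π (S.map g.toEmbedding) = cutWeight (g⁻¹ * π * g) S := by
  rw [cutWeight, cutWeight]
  symm
  refine Finset.sum_bij' (fun p _ => g * p * g⁻¹) (fun p _ => g⁻¹ * p * g)
    (fun p hp => (conj_mem_permsOfFinset g).2 hp) (fun p hp => ?_)
    (fun p _ => by simp [mul_assoc]) (fun p _ => by simp [mul_assoc]) fun p _ => ?_
  · rw [← conj_mem_permsOfFinset g]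
    simpa [mul_assoc] using hp
  · have h1 : (S.map g.toEmbedding)ᶜ = Sᶜ.map g.toEmbedding := by
      ext x
      simp
    have h2 : (g * p * g⁻¹)⁻¹ * π = g * (p⁻¹ * (g⁻¹ * π * g)) * g⁻¹ := by group
    have h3 : signChar (g * p * g⁻¹) = signChar p := by
      rw [map_mul, mul_comm, ← map_mul, inv_mul_cancel_left]
    simp only [h1, h2, h3, conj_mem_permsOfFinset]

theorem exists_map_eq_of_card_eq {S S' : Finset X} (h : S.card = S'.card) :
    ∃ g : Perm X, S.map g.toEmbedding = S' := by
  refine ⟨Equiv.extendSubtype (p := (· ∈ S)) (q := (· ∈ S')) (Finset.equivOfCardEq h), ?_⟩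
  refine Finset.eq_of_subset_of_card_le (fun x hx => ?_) (by rw [Finset.card_map, h])
  obtain ⟨y, hy, rfl⟩ := Finset.mem_map.1 hx
  exact Equiv.extendSubtype_mem _ y hy

/-- Permutations act transitively on subsets of a given size, so the left side depends only on
`C.card`. Summing it over all such subsets and exchanging the sums gives the right side, by `choose
* k! * (n - k)! = n!`. -/
theorem sum_cutWeight_map (π : Perm X) (C : Finset X) :
    ∑ g : Perm X, cutWeight π (C.map g.toEmbedding) =
      (C.card.factorial * Cᶜ.card.factorial : ℂ) *
        ∑ S ∈ Finset.powersetCard C.card Finset.univ, cutWeight π S := by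
  have h1 : ∀ C' ∈ Finset.powersetCard C.card (Finset.univ : Finset X),
      ∑ g : Perm X, cutWeight π (C'.map g.toEmbedding) =
        ∑ g : Perm X, cutWeight π (C.map g.toEmbedding) := by
    intro C' hC'
    obtain ⟨h, rfl⟩ := exists_map_eq_of_card_eq (Finset.mem_powersetCard.1 hC').2.symm
    refine Fintype.sum_equiv (Equiv.mulRight h) _ _ fun g => ?_
    rw [Finset.map_map]
    rfl
  have h2 : ∀ g : Perm X, ∑ C' ∈ Finset.powersetCard C.card (Finset.univ : Finset X),
      cutWeight π (C'.map g.toEmbedding) =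
        ∑ S ∈ Finset.powersetCard C.card Finset.univ, cutWeight π S := by
    intro g
    refine Finset.sum_bij' (fun S _ => S.map g.toEmbedding) (fun S _ => S.map g.symm.toEmbedding)
      (fun S hS => ?_) (fun S hS => ?_) (fun S _ => ?_) (fun S _ => ?_) fun S _ => rfl
    · simpa [Finset.mem_powersetCard] using hS
    · simpa [Finset.mem_powersetCard] using hS
    · ext x; simp
    · ext x; simp
  have h3 := Finset.sum_congr rfl h1
  rw [Finset.sum_comm, Finset.sum_congr rfl fun g _ => h2 g, Finset.sum_const, Finset.sum_const,
    Finset.card_powersetCard, Finset.card_univ, Finset.card_univ, Fintype.card_perm,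
    nsmul_eq_mul, nsmul_eq_mul] at h3
  have h4 : (Fintype.card X).choose C.card * C.card.factorial * Cᶜ.card.factorial =
      (Fintype.card X).factorial := by
    rw [Finset.card_compl]
    exact Nat.choose_mul_factorial_mul_factorial (Finset.card_le_univ C)
  have h5 : ((Fintype.card X).choose C.card : ℂ) ≠ 0 :=
    Nat.cast_ne_zero.2 (Nat.choose_pos (Finset.card_le_univ C)).ne'
  refine mul_left_cancel₀ h5 ?_
  rw [← h3, ← h4]
  push_cast
  ring

/-- Expanding both averages, the trace counts with sign the triples `(g, p, q)` with `g * (p * q) *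
g⁻¹ = σ⁻¹`. For fixed `g` these give the cut weight of a translate of `C`, and the orbit count
cancels the two factorials. -/
theorem twistedTrace_extIdem (σ : Perm X) (C : Finset X) :
    twistedTrace σ (extIdem C) =
      ∑ S ∈ Finset.powersetCard C.card Finset.univ, cutWeight σ⁻¹ S := by
  have h1 : ∀ g : Perm X, cutWeight σ⁻¹ (C.map g.toEmbedding) = ∑ p ∈ permsOfFinset C,
      ∑ q ∈ permsOfFinset Cᶜ, if g * (p * q) * g⁻¹ = σ⁻¹ then signChar p else 0 := by
    intro g
    rw [cutWeight_map, cutWeight]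
    refine Finset.sum_congr rfl fun p _ => ?_
    have h2 : ∀ q : Perm X, g * (p * q) * g⁻¹ = σ⁻¹ ↔ p⁻¹ * (g⁻¹ * σ⁻¹ * g) = q := by
      intro q
      constructor
      · rintro h
        rw [← h]
        group
      · rintro rfl
        group
    simp only [h2]
    rw [Finset.sum_ite_eq]
  have h3 : twistedTrace σ (extIdem C) =
      ((C.card.factorial : ℂ)⁻¹ * (Cᶜ.card.factorial : ℂ)⁻¹) *
        ∑ g : Perm X, cutWeight σ⁻¹ (C.map g.toEmbedding) := by
    simp only [h1]
    rw [Finset.sum_comm, extIdem, symAvg, symAvg, smul_mul_smul_comm, map_smul, smul_eq_mul,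
      Finset.sum_mul_sum, map_sum]
    congr 1
    refine Finset.sum_congr rfl fun p _ => ?_
    rw [map_sum, Finset.sum_comm]
    refine Finset.sum_congr rfl fun q _ => ?_
    rw [single_mul_single, twistedTrace_single]
    simp
  have h4 : (C.card.factorial : ℂ) ≠ 0 := Nat.cast_ne_zero.2 (Nat.factorial_ne_zero _)
  have h5 : (Cᶜ.card.factorial : ℂ) ≠ 0 := Nat.cast_ne_zero.2 (Nat.factorial_ne_zero _)
  rw [h3, sum_cutWeight_map]
  field_simp

/-! ### Signed disjoint factorizations and the cycle polynomial. -/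

theorem signChar_mul_pow_card_support (p : Perm X) :
    (C (signChar p) * Polynomial.X ^ p.support.card : ℂ[X]) =
      ∏ c ∈ p.cycleFactorsFinset, -(-Polynomial.X) ^ c.support.card := by
  have h : ∀ m : Multiset ℕ, ((-1) ^ (m.sum + Multiset.card m) * Polynomial.X ^ m.sum : ℂ[X]) =
      (m.map fun d => -(-Polynomial.X : ℂ[X]) ^ d).prod := by
    intro m
    induction m using Multiset.induction_on with
    | empty => simp
    | cons a m ih =>
      rw [Multiset.map_cons, Multiset.prod_cons, ← ih, Multiset.sum_cons, Multiset.card_cons,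
        neg_pow (Polynomial.X : ℂ[X]) a]
      ring
  have h2 := h p.cycleType
  rw [Perm.sum_cycleType, Perm.cycleType_def, Multiset.map_map, ← Perm.cycleType_def] at h2
  rw [Finset.prod_eq_multiset_prod]
  refine Eq.trans ?_ h2
  rw [signChar_apply, Perm.sign_of_cycleType, Perm.sum_cycleType]
  simp

/-- A left factor of `π` whose support is disjoint from that of its cofactor is the product of a
subset of the cycles of `π`; such subsets index the expansion of the product. A `d`-cycle has sign
`(-1) ^ (d - 1)`, hence contributes `-(-X) ^ d`. -/
theorem sum_disjoint_left_factors (π : Perm X) :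
    ∑ p : Perm X with Disjoint p.support (p⁻¹ * π).support, (C (signChar p) * Polynomial.X ^ p.support.card : ℂ[X]) =
      (π.cycleType.map fun d => 1 - (-Polynomial.X : ℂ[X]) ^ d).prod := by
  rw [Perm.cycleType_def, Multiset.map_map]
  change _ = ∏ c ∈ π.cycleFactorsFinset, (1 - (-Polynomial.X : ℂ[X]) ^ c.support.card)
  simp only [sub_eq_add_neg]
  rw [Finset.prod_one_add]
  refine Finset.sum_bij (fun p _ => p.cycleFactorsFinset) (fun p hp => ?_)
    (fun p _ q _ h => Perm.cycleFactorsFinset_injective h) (fun U hU => ?_)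
    fun p _ => signChar_mul_pow_card_support p
  · have h := (Perm.disjoint_iff_disjoint_support.2
      (Finset.mem_filter.1 hp).2).cycleFactorsFinset_mul_eq_union
    rw [mul_inv_cancel_left] at h
    rw [Finset.mem_powerset, h]
    exact Finset.subset_union_left
  · rw [Finset.mem_powerset] at hU
    have hd := Perm.cycleFactorsFinset_pairwise_disjoint π
    have hV : π.cycleFactorsFinset \ U ⊆ π.cycleFactorsFinset := Finset.sdiff_subset
    have hdU : (U : Set (Perm X)).Pairwise Perm.Disjoint := hd.mono hU
    have hdV : ((π.cycleFactorsFinset \ U : Finset _) : Set (Perm X)).Pairwise Perm.Disjoint :=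
      hd.mono hV
    have hcU : (U : Set (Perm X)).Pairwise (Function.onFun Commute id) :=
      hdU.mono' fun _ _ => Perm.Disjoint.commute
    have hcV : ((π.cycleFactorsFinset \ U : Finset _) : Set (Perm X)).Pairwise
        (Function.onFun Commute id) := hdV.mono' fun _ _ => Perm.Disjoint.commute
    have hπ : U.noncommProd id hcU * (π.cycleFactorsFinset \ U).noncommProd id hcV = π := by
      rw [← Finset.noncommProd_union_of_disjoint Finset.disjoint_sdiff id]
      · conv_rhs => rw [← Perm.cycleFactorsFinset_noncommProd π]
        exact Finset.noncommProd_congr (Finset.union_sdiff_of_subset hU) (fun _ _ => rfl) _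
      · rw [Finset.union_sdiff_of_subset hU]
        exact Perm.cycleFactorsFinset_mem_commute π
    have hUf : (U.noncommProd id hcU).cycleFactorsFinset = U :=
      Perm.cycleFactorsFinset_eq_finset.2
        ⟨fun f hf => (Perm.mem_cycleFactorsFinset_iff.1 (hU hf)).1, hdU, rfl⟩
    refine ⟨U.noncommProd id hcU, ?_, hUf⟩
    rw [Finset.mem_filter]
    refine ⟨Finset.mem_univ _, ?_⟩
    have hq : (U.noncommProd id hcU)⁻¹ * π = (π.cycleFactorsFinset \ U).noncommProd id hcV := by
      rw [inv_mul_eq_iff_eq_mul, hπ]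
    rw [hq, ← Perm.disjoint_iff_disjoint_support]
    refine Perm.disjoint_noncommProd_right hcV fun c hc => ?_
    refine (Perm.disjoint_noncommProd_right hcU fun e he => ?_).symm
    refine hd (hV hc) (hU he) ?_
    rintro rfl
    exact (Finset.mem_sdiff.1 hc).2 he

theorem mem_permsOfFinset_iff_support {S : Finset X} {p : Perm X} :
    p ∈ permsOfFinset S ↔ p.support ⊆ S := by
  rw [mem_perms_of_finset_iff]
  simp [Finset.subset_iff]

theorem sum_Icc_pow_card {A B : Finset X} (h : A ⊆ B) :
    ∑ S ∈ Finset.Icc A B, (Polynomial.X : ℂ[X]) ^ S.card =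
      Polynomial.X ^ A.card * (1 + Polynomial.X) ^ (B.card - A.card) := by
  rw [Finset.Icc_eq_image_powerset h, Finset.sum_image, ← Finset.card_sdiff_of_subset h, add_comm (1 : ℂ[X]),
    ← Finset.sum_pow_mul_eq_add_pow, Finset.mul_sum]
  · refine Finset.sum_congr rfl fun U hU => ?_
    have : Disjoint A U := Finset.disjoint_sdiff.mono_right (Finset.mem_powerset.1 hU)
    rw [Finset.card_union_of_disjoint this, one_pow, mul_one, pow_add]
  · intro U hU V hV hUV
    have hU' : Disjoint A U := Finset.disjoint_sdiff.mono_right (Finset.mem_powerset.1 hU)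
    have hV' : Disjoint A V := Finset.disjoint_sdiff.mono_right (Finset.mem_powerset.1 hV)
    have := congrArg (· \ A) hUV
    simpa [Finset.union_sdiff_cancel_left hU', Finset.union_sdiff_cancel_left hV'] using this

/-- For a fixed factor `p`, the admissible `S` consist of the support of `p` and any set of fixed
points of `π`. Each fixed point contributes `1 + X = 1 - (-X) ^ 1`, the factor belonging to a part
`1`; the nontrivial cycles are handled by `sum_disjoint_left_factors`. -/
theorem sum_cutWeight_mul_pow (π : Perm X) :
    ∑ S : Finset X, (C (cutWeight π S) * Polynomial.X ^ S.card : ℂ[X]) =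
      (π.partition.parts.map fun d => 1 - (-Polynomial.X : ℂ[X]) ^ d).prod := by
  have h1 : ∀ S : Finset X, (C (cutWeight π S) * Polynomial.X ^ S.card : ℂ[X]) =
      ∑ p : Perm X, if S ∈ Finset.Icc p.support (p⁻¹ * π).supportᶜ then
        C (signChar p) * Polynomial.X ^ S.card else 0 := by
    intro S
    rw [cutWeight, map_sum, Finset.sum_mul, ← Finset.sum_subset (Finset.subset_univ (permsOfFinset S))]
    · refine Finset.sum_congr rfl fun p hp => ?_
      have h : S ∈ Finset.Icc p.support (p⁻¹ * π).supportᶜ ↔ p⁻¹ * π ∈ permsOfFinset Sᶜ := by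
        rw [Finset.mem_Icc, mem_permsOfFinset_iff_support, Finset.subset_compl_comm]
        exact and_iff_right (mem_permsOfFinset_iff_support.1 hp)
      by_cases h' : p⁻¹ * π ∈ permsOfFinset Sᶜ
      · rw [if_pos h', if_pos (h.2 h')]
      · rw [if_neg h', if_neg (mt h.1 h'), C_0, zero_mul]
    · intro p _ hp
      refine if_neg fun h => hp ?_
      exact mem_permsOfFinset_iff_support.2 (Finset.mem_Icc.1 h).1
  have h2 : ∀ p : Perm X, (∑ S : Finset X, if S ∈ Finset.Icc p.support (p⁻¹ * π).supportᶜ then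
        (C (signChar p) * Polynomial.X ^ S.card : ℂ[X]) else 0) =
      if Disjoint p.support (p⁻¹ * π).support then (C (signChar p) * Polynomial.X ^ p.support.card) *
        (1 + Polynomial.X) ^ (Fintype.card X - π.support.card) else 0 := by
    intro p
    have hiff : Disjoint p.support (p⁻¹ * π).support ↔ p.support ⊆ (p⁻¹ * π).supportᶜ := by
      rw [Finset.subset_compl_iff_disjoint_right]
    rw [← Finset.sum_filter, Finset.filter_mem_eq_inter, Finset.univ_inter, ← Finset.mul_sum]
    split_ifs with h
    · have hc := (Perm.disjoint_iff_disjoint_support.2 h).card_support_mul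
      rw [mul_inv_cancel_left] at hc
      rw [sum_Icc_pow_card (hiff.1 h), Finset.card_compl, hc, Nat.sub_sub, mul_assoc,
        add_comm p.support.card]
    · rw [Finset.Icc_eq_empty (fun h' => h (hiff.2 h')), Finset.sum_empty, mul_zero]
  rw [Finset.sum_congr rfl fun S _ => h1 S, Finset.sum_comm, Finset.sum_congr rfl fun p _ => h2 p,
    ← Finset.sum_filter, ← Finset.sum_mul, sum_disjoint_left_factors, Perm.parts_partition,
    Multiset.map_add, Multiset.prod_add, Multiset.map_replicate, Multiset.prod_replicate, pow_one,
    sub_neg_eq_add]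

/-- The exterior power character: `σ⁻¹` has the cycle type of `σ`, and substituting `-X` for `X`
produces the sign. -/
theorem twistedTrace_extIdem_eq_coeff (σ : Perm X) (S : Finset X) :
    twistedTrace σ (extIdem S) = (-1) ^ S.card *
      (σ.partition.parts.map fun d => 1 - (Polynomial.X : ℂ[X]) ^ d).prod.coeff S.card := by
  have h1 : (σ⁻¹).partition.parts = σ.partition.parts := by
    rw [Perm.parts_partition, Perm.parts_partition, Perm.cycleType_inv, Perm.support_inv]
  have h2 : (σ.partition.parts.map fun d => 1 - (-Polynomial.X : ℂ[X]) ^ d).prod =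
      ((σ.partition.parts.map fun d => 1 - (Polynomial.X : ℂ[X]) ^ d).prod).comp (C (-1) * Polynomial.X) := by
    rw [← Polynomial.coe_compRingHom_apply, map_multiset_prod, Multiset.map_map]
    simp
  have h3 := congrArg (fun P : ℂ[X] => P.coeff S.card) (sum_cutWeight_mul_pow σ⁻¹)
  simp only [h1, h2, Polynomial.finsetSum_coeff, Polynomial.coeff_C_mul_X_pow,
    Polynomial.comp_C_mul_X_coeff] at h3
  rw [← Finset.sum_filter] at h3
  rw [twistedTrace_extIdem, mul_comm, ← h3]
  refine Finset.sum_congr ?_ fun _ _ => rfl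
  ext U
  simp [eq_comm]

end TwistedTrace

/-! ### The characters attached to hooks -/

section HookCharacter

open MonoidAlgebra Equiv

section

variable {X : Type*} [Fintype X] [DecidableEq X]

/-- Taking traces in `extIdem_homotopy` expresses the exterior power character as the sum of two
consecutive hook characters. Induction on `S` solves this recursion; the prefactors are those making
`extIdem S * extIdem (insert c S)` idempotent. -/
theorem twistedTrace_hook (σ : Perm X) (S : Finset X) : ∀ c ∉ S,
    ((S.card + 1 : ℂ) * Sᶜ.card) * twistedTrace σ (extIdem S * extIdem (insert c S)) =
      Fintype.card X * ((-1) ^ S.card * ∑ t ∈ Finset.range (S.card + 1),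
        (σ.partition.parts.map fun d => 1 - (Polynomial.X : ℂ[X]) ^ d).prod.coeff t) := by
  induction S using Finset.induction_on with
  | empty =>
    intro c hc
    have h := extIdem_mul_extIdem_insert_mul hc
    simp only [Finset.card_empty, Nat.cast_zero, zero_add, one_smul, Finset.sum_empty, sub_zero] at h
    have h2 := congrArg (twistedTrace σ) h
    rw [twistedTrace_mul_comm, ← mul_assoc, extIdem_mul_self, twistedTrace_extIdem_eq_coeff] at h2
    rw [h2]
    simp
  | insert x S hx ih =>
    intro c hc
    have h := congrArg (twistedTrace σ) (extIdem_homotopy hx hc)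
    rw [map_add, map_smul, map_smul, map_smul, twistedTrace_mul_comm σ (extIdem _ * _),
      twistedTrace_mul_comm σ (extIdem _ * _), ← mul_assoc, ← mul_assoc, extIdem_mul_self,
      twistedTrace_mul_comm σ (extIdem _) (extIdem S), twistedTrace_extIdem_eq_coeff] at h
    have h1 := ih x hx
    have h2 : Sᶜ.card = (insert x S)ᶜ.card + 1 := by
      have e1 := Finset.card_add_card_compl S
      have e2 := Finset.card_add_card_compl (insert x S)
      rw [Finset.card_insert_of_notMem hx] at e2
      omega
    rw [Finset.card_insert_of_notMem hx] at h ⊢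
    rw [h2] at h1
    simp only [smul_eq_mul] at h
    push_cast at h h1 ⊢
    rw [Finset.sum_range_succ _ (S.card + 1), pow_succ] at *
    linear_combination -h - h1

/-- Right multiplication by the idempotent `k⁻¹ • y` projects onto the left ideal, so the trace on
the ideal is that of the composite with this projection on the whole algebra. -/
theorem trace_restrict_range_mulRight (σ : Perm X) {y : MonoidAlgebra ℂ (Perm X)} {k : ℂ}
    (hk : k ≠ 0) (hy : y * y = k • y)
    (h : ∀ x ∈ LinearMap.range (LinearMap.mulRight ℂ y),
      LinearMap.mulLeft ℂ (single σ (1 : ℂ)) x ∈ LinearMap.range (LinearMap.mulRight ℂ y)) :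
    k * LinearMap.trace ℂ _ ((LinearMap.mulLeft ℂ (single σ (1 : ℂ))).restrict h) =
      twistedTrace σ y := by
  have hmem : ∀ x, (LinearMap.mulLeft ℂ (single σ (1 : ℂ)) * LinearMap.mulRight ℂ (k⁻¹ • y) :
      Module.End ℂ (MonoidAlgebra ℂ (Perm X))) x ∈
      LinearMap.range (LinearMap.mulRight ℂ y) := fun x =>
    ⟨k⁻¹ • (single σ 1 * x), by simp [mul_assoc]⟩
  have h1 := LinearMap.trace_restrict_eq_of_forall_mem _ _ hmem
  have h2 : (LinearMap.mulLeft ℂ (single σ (1 : ℂ))).restrict h =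
      (LinearMap.mulLeft ℂ (single σ 1) * LinearMap.mulRight ℂ (k⁻¹ • y)).restrict
        (fun x _ => hmem x) := by
    refine LinearMap.ext fun x => Subtype.ext ?_
    obtain ⟨_, x, rfl⟩ := x
    simp [LinearMap.restrict_apply, mul_assoc, hy, smul_smul, hk]
  rw [h2, h1, ← twistedTrace_apply, map_smul, smul_eq_mul, mul_inv_cancel_left₀ hk]

end

/-! ### The hook diagram and its Young symmetrizer. -/

theorem mem_cells_hook {r s : ℕ} (hr : 1 ≤ r) {c : ℕ × ℕ} :
    c ∈ (youngDiagramOf (hook r s)).cells ↔ c.1 = 0 ∧ c.2 < r ∨ c.2 = 0 ∧ 1 ≤ c.1 ∧ c.1 ≤ s := by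
  have h1 : (hook r s).parts = ((r :: List.replicate s 1 : List ℕ) : Multiset ℕ) := by
    rw [hook, Nat.Partition.ofSums_parts, Multiset.filter_eq_self.2]
    · rfl
    · intro a ha
      rcases Multiset.mem_cons.1 ha with rfl | h
      · omega
      · rw [Multiset.eq_of_mem_replicate h]; exact one_ne_zero
  have h2 : (hook r s).parts.sort (· ≥ ·) = r :: List.replicate s 1 := by
    rw [h1]
    refine List.Perm.eq_of_pairwise (le := (· ≥ ·)) (fun a b _ _ h h' => le_antisymm h' h)
      (Multiset.pairwise_sort _ _) ?_ (Multiset.coe_eq_coe.1 (Multiset.sort_eq _ _))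
    rw [List.pairwise_cons]
    exact ⟨fun b hb => by rw [List.eq_of_mem_replicate hb]; exact hr, List.pairwise_replicate_of_refl⟩
  have h3 : (youngDiagramOf (hook r s)).cells =
      YoungDiagram.cellsOfRowLens (r :: List.replicate s 1) := by
    rw [← h2]; rfl
  rw [h3, YoungDiagram.mem_cellsOfRowLens]
  obtain ⟨i, j⟩ := c
  rcases i with _ | i
  · simp
  · simp
    omega

theorem symChar_hook {r s : ℕ} (hr : 1 ≤ r) (σ : Perm (Box (hook r s))) :
    symChar (hook r s) σ = (-1) ^ s * ∑ t ∈ Finset.range (s + 1),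
      (σ.partition.parts.map fun d => 1 - (Polynomial.X : ℂ[X]) ^ d).prod.coeff t := by
  let c₀ : Box (hook r s) := ⟨(0, 0), (mem_cells_hook hr).2 (Or.inl ⟨rfl, hr⟩)⟩
  -- `S` is the leg: its complement is the first row, and adding the corner `c₀` gives the first
  -- column.
  let S : Finset (Box (hook r s)) := Finset.univ.filter fun c => c.1.1 ≠ 0
  have hc₀ : c₀ ∉ S := by simp [S, c₀]
  have hmem : ∀ c : Box (hook r s), c.1.1 = 0 ∧ c.1.2 < r ∨ c.1.2 = 0 ∧ 1 ≤ c.1.1 ∧ c.1.1 ≤ s :=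
    fun c => (mem_cells_hook hr).1 c.2
  have hS : ∀ c : Box (hook r s), c ∈ Sᶜ ↔ c.1.1 = 0 := by simp [S]
  have hS' : ∀ c : Box (hook r s), c ∈ insert c₀ S ↔ c.1.2 = 0 := by
    intro c
    have := hmem c
    simp only [S, Finset.mem_insert, Finset.mem_filter, Finset.mem_univ, true_and, c₀,
      Subtype.ext_iff, Prod.ext_iff]
    omega
  have hcard : S.card = s := by
    refine Eq.trans ?_ (Finset.card_range s)
    refine Finset.card_bij (fun c _ => c.1.1 - 1) (fun c hc => ?_) (fun c hc d hd h => ?_)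
      (fun i hi => ?_)
    · have := hmem c
      simp only [S, Finset.mem_filter] at hc
      simp only [Finset.mem_range]
      omega
    · have := hmem c
      have := hmem d
      simp only [S, Finset.mem_filter] at hc hd
      refine Subtype.ext (Prod.ext ?_ ?_) <;> omega
    · rw [Finset.mem_range] at hi
      exact ⟨⟨(i + 1, 0), (mem_cells_hook hr).2 (Or.inr ⟨rfl, by simp, by simpa using hi⟩)⟩,
        by simp [S], by simp⟩
  -- Every row but the first is a single box, so a row-preserving permutation is one supported in
  -- the first row; likewise for columns in `hcol`.
  have hrow : rowSymmetrizer (hook r s) = (Sᶜ.card.factorial : ℂ) • symAvg 1 Sᶜ := by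
    rw [symAvg, smul_smul, mul_inv_cancel₀ (Nat.cast_ne_zero.2 (Nat.factorial_ne_zero _)), one_smul,
      rowSymmetrizer]
    refine Finset.sum_congr ?_ fun _ _ => rfl
    ext p
    rw [Finset.mem_filter, mem_permsOfFinset]
    refine ⟨fun h c hc => ?_, fun h => ⟨Finset.mem_univ _, fun c => ?_⟩⟩
    · rw [hS] at hc
      have h1 := h.2 c
      have h2 := hmem c
      have h3 := hmem (p c)
      refine Subtype.ext (Prod.ext h1 ?_)
      omega
    · by_cases hc : c ∈ Sᶜ
      · have h1 : p c ∈ Sᶜ := by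
          by_contra h1
          exact h1 (by rwa [p.injective (h _ h1)])
        rw [(hS _).1 h1, (hS _).1 hc]
      · rw [h c hc]
  have hcol : colAntisymmetrizer (hook r s) =
      ((insert c₀ S).card.factorial : ℂ) • symAvg signChar (insert c₀ S) := by
    rw [symAvg, smul_smul, mul_inv_cancel₀ (Nat.cast_ne_zero.2 (Nat.factorial_ne_zero _)), one_smul,
      colAntisymmetrizer]
    refine Finset.sum_congr ?_ fun _ _ => rfl
    ext p
    rw [Finset.mem_filter, mem_permsOfFinset]
    refine ⟨fun h c hc => ?_, fun h => ⟨Finset.mem_univ _, fun c => ?_⟩⟩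
    · rw [hS'] at hc
      have h1 := h.2 c
      have h2 := hmem c
      have h3 := hmem (p c)
      refine Subtype.ext (Prod.ext ?_ h1)
      omega
    · by_cases hc : c ∈ insert c₀ S
      · have h1 : p c ∈ insert c₀ S := by
          by_contra h1
          exact h1 (by rwa [p.injective (h _ h1)])
        rw [(hS' _).1 h1, (hS' _).1 hc]
      · rw [h c hc]
  set z := extIdem S * extIdem (insert c₀ S) with hz
  set a : ℂ := Sᶜ.card.factorial * (insert c₀ S).card.factorial with ha
  have ha0 : a ≠ 0 := mul_ne_zero (Nat.cast_ne_zero.2 (Nat.factorial_ne_zero _))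
    (Nat.cast_ne_zero.2 (Nat.factorial_ne_zero _))
  have hy : youngSymmetrizer (hook r s) = a • z := by
    rw [youngSymmetrizer, hrow, hcol, smul_mul_smul_comm, hz, extIdem_mul_extIdem_insert_eq]
  have hn : (Fintype.card (Box (hook r s)) : ℂ) ≠ 0 :=
    Nat.cast_ne_zero.2 (Fintype.card_pos_iff.2 ⟨c₀⟩).ne'
  set m : ℂ := (S.card + 1 : ℂ) * Sᶜ.card with hm
  have hm0 : m ≠ 0 := mul_ne_zero (Nat.cast_add_one_ne_zero _)
    (Nat.cast_ne_zero.2 (Finset.card_pos.2 ⟨c₀, Finset.mem_compl.2 hc₀⟩).ne')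
  have hzz : z * z = (m⁻¹ * Fintype.card (Box (hook r s))) • z := by
    rw [mul_smul, ← hookIdem_mul_self hc₀, smul_smul, inv_mul_cancel₀ hm0, one_smul]
  have hyy : youngSymmetrizer (hook r s) * youngSymmetrizer (hook r s) =
      (a * (m⁻¹ * Fintype.card (Box (hook r s)))) • youngSymmetrizer (hook r s) := by
    rw [hy, smul_mul_smul_comm, hzz, smul_smul, smul_smul]
    congr 1
    ring
  have h1 := trace_restrict_range_mulRight σ
    (mul_ne_zero ha0 (mul_ne_zero (inv_ne_zero hm0) hn)) hyy (by
      rintro _ ⟨x, rfl⟩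
      exact ⟨single σ (1 : ℂ) * x, by simp [mul_assoc]⟩)
  have h2 := twistedTrace_hook σ S c₀ hc₀
  rw [hcard] at h2
  change _ * symChar (hook r s) σ = _ at h1
  rw [hy, map_smul, smul_eq_mul, mul_assoc] at h1
  have h3 := mul_left_cancel₀ ha0 h1
  refine mul_left_cancel₀ hn ?_
  have hm' : m = (s + 1 : ℂ) * Sᶜ.card := by rw [hm, hcard]
  rw [← h2, ← hz, ← h3, ← hm']
  field_simp

end HookCharacter

/-! ### Divisor sums of the Möbius function -/

section DivisorSums

open UniqueFactorizationMonoid hiding moebius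

variable {F : Type*} [Field F]

open Classical in
theorem normalizedFactors_prod_of_subset {f : F[X]} (hf : f ≠ 0) {U : Finset F[X]}
    (hU : U ⊆ (normalizedFactors f).toFinset) : normalizedFactors (∏ P ∈ U, P) = U.val := by
  have h : ∀ P ∈ U, Irreducible P ∧ P.Monic ∧ P ∣ f := fun P hP =>
    (Polynomial.mem_normalizedFactors_iff hf).1 (Multiset.mem_toFinset.1 (hU hP))
  rw [Finset.prod_eq_multiset_prod, normalizedFactors_prod_eq]
  · rw [Multiset.map_id', Multiset.map_congr rfl fun P hP => (h P hP).2.1.normalize_eq_self,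
      Multiset.map_id']
  · intro P hP
    rw [Multiset.map_id'] at hP
    exact (h P hP).1

open Classical in
theorem prod_normalizedFactors_of_monic {g : F[X]} (hg : g.Monic) :
    (normalizedFactors g).prod = g := by
  have h := leadingCoeff_mul_prod_normalizedFactors g
  rwa [hg.leadingCoeff, C_1, one_mul] at h

theorem sum_factorizationType {f : F[X]} (hf : f.Monic) :
    (factorizationType f).sum = f.natDegree := by
  classical
  conv_rhs => rw [← prod_normalizedFactors_of_monic hf]
  rw [natDegree_multiset_prod _ (zero_notMem_normalizedFactors f)]
  rfl

open Classical in
theorem setOf_monic_dvd_eq {f : F[X]} (hf : f.Monic) (hsq : Squarefree f) :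
    {g : F[X] | g.Monic ∧ g ∣ f} =
      ↑((normalizedFactors f).toFinset.powerset.image fun U => ∏ P ∈ U, P) := by
  have hnd := (squarefree_iff_nodup_normalizedFactors hf.ne_zero).1 hsq
  ext g
  rw [Set.mem_ofPred_eq, Finset.mem_coe, Finset.mem_image]
  constructor
  · rintro ⟨hg, hgf⟩
    have hle := (dvd_iff_normalizedFactors_le_normalizedFactors hg.ne_zero hf.ne_zero).1 hgf
    refine ⟨(normalizedFactors g).toFinset, ?_, ?_⟩
    · exact Finset.mem_powerset.2 (Multiset.toFinset_subset.2 (Multiset.subset_of_le hle))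
    · rw [Finset.prod_eq_multiset_prod, Multiset.toFinset_val,
        (Multiset.nodup_of_le hle hnd).dedup, Multiset.map_id',
        prod_normalizedFactors_of_monic hg]
  · rintro ⟨U, hU, rfl⟩
    rw [Finset.mem_powerset] at hU
    constructor
    · exact monic_prod_of_monic _ _ fun P hP =>
        ((Polynomial.mem_normalizedFactors_iff hf.ne_zero).1 (Multiset.mem_toFinset.1 (hU hP))).2.1
    · conv_rhs => rw [← prod_normalizedFactors_of_monic hf]
      rw [Finset.prod_eq_multiset_prod, Multiset.map_id']
      exact Multiset.prod_dvd_prod_of_le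
        ((Multiset.le_iff_subset U.nodup).2 fun P hP => Multiset.mem_toFinset.1 (hU hP))

/-- A weighted divisor sum of the Möbius function, in terms of the generating polynomial
`∏ (1 - X ^ deg P)`. -/
theorem finsum_moebius_mul {f : F[X]} (hf : f.Monic) (hsq : Squarefree f) (φ : ℕ → ℂ) :
    ∑ᶠ g ∈ {g : F[X] | g.Monic ∧ g ∣ f}, moebius g * φ g.natDegree =
      ∑ t ∈ Finset.range (f.natDegree + 1),
        ((factorizationType f).map fun d => 1 - (X : ℂ[X]) ^ d).prod.coeff t * φ t := by
  classical
  have hnd := (squarefree_iff_nodup_normalizedFactors hf.ne_zero).1 hsq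
  -- Choosing the second summand in the factors indexed by `U` yields the divisor `∏ P ∈ U, P`, with
  -- sign `(-1) ^ U.card` equal to its Möbius value.
  have hG : ((factorizationType f).map fun d => 1 - (X : ℂ[X]) ^ d).prod =
      ∑ U ∈ (normalizedFactors f).toFinset.powerset,
        C ((-1 : ℂ) ^ U.card) * X ^ (∏ P ∈ U, P).natDegree := by
    rw [factorizationType, Multiset.map_map]
    have h1 : (Multiset.map ((fun d => 1 - (X : ℂ[X]) ^ d) ∘ natDegree) (normalizedFactors f)).prod =
        ∏ P ∈ (normalizedFactors f).toFinset, (1 + -(X : ℂ[X]) ^ P.natDegree) := by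
      rw [Finset.prod_eq_multiset_prod, Multiset.toFinset_val, hnd.dedup]
      simp only [Function.comp_def, sub_eq_add_neg]
    rw [h1, Finset.prod_one_add]
    refine Finset.sum_congr rfl fun U hU => ?_
    rw [natDegree_prod_of_monic, Finset.prod_neg, Finset.prod_pow_eq_pow_sum, C_pow, C_neg, C_1]
    intro P hP
    exact ((Polynomial.mem_normalizedFactors_iff hf.ne_zero).1
      (Multiset.mem_toFinset.1 (Finset.mem_powerset.1 hU hP))).2.1
  have hmem : ∀ U ∈ (normalizedFactors f).toFinset.powerset,
      (∏ P ∈ U, P).Monic ∧ (∏ P ∈ U, P) ∣ f := by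
    intro U hU
    have : (∏ P ∈ U, P) ∈ {g : F[X] | g.Monic ∧ g ∣ f} := by
      rw [setOf_monic_dvd_eq hf hsq]
      exact Finset.mem_coe.2 (Finset.mem_image_of_mem _ hU)
    exact this
  rw [setOf_monic_dvd_eq hf hsq, finsum_mem_coe_finset, Finset.sum_image, hG]
  · simp only [finsetSum_coeff, Finset.sum_mul]
    rw [Finset.sum_comm]
    refine Finset.sum_congr rfl fun U hU => ?_
    have hle : (∏ P ∈ U, P).natDegree ≤ f.natDegree := natDegree_le_of_dvd (hmem U hU).2 hf.ne_zero
    rw [Finset.sum_eq_single (∏ P ∈ U, P).natDegree]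
    · rw [coeff_C_mul_X_pow, if_pos rfl, moebius, if_pos (hsq.squarefree_of_dvd (hmem U hU).2),
        normalizedFactors_prod_of_subset hf.ne_zero (Finset.mem_powerset.1 hU)]
      rfl
    · intro t _ ht
      rw [coeff_C_mul_X_pow, if_neg ht, zero_mul]
    · intro h
      exact absurd (Finset.mem_range.2 (Nat.lt_succ_of_le hle)) h
  · intro U hU V hV h
    have hU' := normalizedFactors_prod_of_subset hf.ne_zero (Finset.mem_powerset.1 hU)
    have hV' := normalizedFactors_prod_of_subset hf.ne_zero (Finset.mem_powerset.1 hV)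
    exact Finset.val_injective (by rw [← hU', ← hV']; exact congrArg _ h)

theorem truncMoebiusSum_eq {f : F[X]} (hf : f.Monic) (hsq : Squarefree f) {s : ℕ}
    (hs : s ≤ f.natDegree) : truncMoebiusSum s f = ∑ t ∈ Finset.range (s + 1),
      ((factorizationType f).map fun d => 1 - (X : ℂ[X]) ^ d).prod.coeff t := by
  have h1 : truncMoebiusSum s f = ∑ᶠ g ∈ {g : F[X] | g.Monic ∧ g ∣ f},
      moebius g * (if g.natDegree ≤ s then 1 else 0) := by
    rw [truncMoebiusSum]
    refine finsum_congr fun g => ?_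
    by_cases h : g.Monic ∧ g ∣ f
    · by_cases h' : g.natDegree ≤ s <;> simp [h, h']
    · have h' : ¬(g.Monic ∧ g ∣ f ∧ g.natDegree ≤ s) := fun h' => h ⟨h'.1, h'.2.1⟩
      simp only [Set.mem_ofPred_eq, h, h', finsum_false]
  rw [h1, finsum_moebius_mul hf hsq fun d => if d ≤ s then 1 else 0]
  simp only [mul_ite, mul_one, mul_zero]
  rw [← Finset.sum_filter]
  refine Finset.sum_congr ?_ fun _ _ => rfl
  ext t
  simp only [Finset.mem_filter, Finset.mem_range]
  omega

/-! ### Von Mangoldt functions and summation over hooks. -/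

theorem higherVonMangoldt_eq {f : F[X]} (hf : f.Monic) (hsq : Squarefree f) (j : ℕ) :
    higherVonMangoldt j f = ∑ t ∈ Finset.range (f.natDegree + 1),
      ((factorizationType f).map fun d => 1 - (X : ℂ[X]) ^ d).prod.coeff t *
        ((f.natDegree - t : ℕ) : ℂ) ^ j := by
  rw [← finsum_moebius_mul hf hsq fun t => ((f.natDegree - t : ℕ) : ℂ) ^ j, higherVonMangoldt]
  refine finsum_mem_congr rfl fun g hg => ?_
  have h : f / g = f /ₘ g := (divByMonic_eq_div f hg.1).symm
  rw [h, natDegree_divByMonic f hg.1]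

/-- The factorization type is a partition of `r + s`, hence the cycle type of some permutation of
the boxes, to which `symChar_hook` applies. -/
theorem polyChar_hook {f : F[X]} (hf : f.Monic) (hsq : Squarefree f) {r s : ℕ} (hr : 1 ≤ r)
    (hn : f.natDegree = r + s) : polyChar (hook r s) f = (-1) ^ s * ∑ t ∈ Finset.range (s + 1),
      ((factorizationType f).map fun d => 1 - (X : ℂ[X]) ^ d).prod.coeff t := by
  classical
  let τ : (r + s).Partition :=
    { parts := factorizationType f
      parts_pos := by
        intro i hi
        obtain ⟨P, hP, rfl⟩ := Multiset.mem_map.1 hi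
        exact ((Polynomial.mem_normalizedFactors_iff hf.ne_zero).1 hP).1.natDegree_pos
      parts_sum := by rw [sum_factorizationType hf, hn] }
  obtain ⟨σ, hσ⟩ := exists_perm_partition (hook r s) τ
  have hσ' : σ.partition.parts = factorizationType f := hσ
  rw [polyChar, if_pos ⟨hn, hsq⟩, ← hσ', symCharAt_partition, symChar_hook hr]

/-- Abel summation: for fixed `t` the differences of `h` telescope over `1 ≤ r ≤ n - t`. The
condition `h 0 = 0` removes the lower boundary and the term `t = n`. -/
theorem sum_Icc_sub_mul_sum_range (M h : ℕ → ℂ) (h0 : h 0 = 0) (n : ℕ) :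
    ∑ r ∈ Finset.Icc 1 n, (h r - h (r - 1)) * ∑ t ∈ Finset.range (n - r + 1), M t =
      ∑ t ∈ Finset.range (n + 1), M t * h (n - t) := by
  have h1 : ∑ r ∈ Finset.Icc 1 n, (h r - h (r - 1)) * ∑ t ∈ Finset.range (n - r + 1), M t =
      ∑ i ∈ Finset.range n, ∑ t ∈ Finset.range (n - i), (h (i + 1) - h i) * M t := by
    simp only [Finset.mul_sum]
    refine Finset.sum_bij' (fun r _ => r - 1) (fun i _ => i + 1) ?_ ?_ ?_ ?_ fun r hr => ?_
    · intro r hr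
      rw [Finset.mem_Icc] at hr
      rw [Finset.mem_range]
      omega
    · intro i hi
      rw [Finset.mem_range] at hi
      rw [Finset.mem_Icc]
      omega
    · intro r hr
      exact Nat.sub_add_cancel (Finset.mem_Icc.1 hr).1
    · intro i _
      exact Nat.add_sub_cancel _ _
    · rw [Finset.mem_Icc] at hr
      rw [Nat.sub_add_cancel hr.1, show n - r + 1 = n - (r - 1) by omega]
  rw [h1, Finset.sum_range_succ, Nat.sub_self, h0, mul_zero, add_zero,
    Finset.sum_comm' (t' := Finset.range n) (s' := fun t => Finset.range (n - t))]
  · refine Finset.sum_congr rfl fun t _ => ?_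
    rw [← Finset.sum_mul, Finset.sum_range_sub, h0, sub_zero, mul_comm]
  · intro i t
    simp only [Finset.mem_range]
    omega

theorem higherVonMangoldt_eq_sum_polyChar {f : F[X]} (hf : f.Monic) (hsq : Squarefree f) {j : ℕ}
    (hj : 1 ≤ j) : higherVonMangoldt j f = ∑ r ∈ Finset.Icc 1 f.natDegree,
      (-1) ^ (f.natDegree - r) * ((r : ℂ) ^ j - ((r : ℂ) - 1) ^ j) *
        polyChar (hook r (f.natDegree - r)) f := by
  -- Here `1 ≤ j` is what makes `0 ^ j = 0`.
  rw [higherVonMangoldt_eq hf hsq, ← sum_Icc_sub_mul_sum_range _ (fun k => (k : ℂ) ^ j)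
    (by simp; omega)]
  refine Finset.sum_congr rfl fun r hr => ?_
  rw [Finset.mem_Icc] at hr
  rw [polyChar_hook hf hsq hr.1 (by omega), Nat.cast_sub hr.1, Nat.cast_one]
  have h : ((-1 : ℂ) ^ (f.natDegree - r)) * (-1) ^ (f.natDegree - r) = 1 := by
    rw [← mul_pow]; simp
  linear_combination -((r : ℂ) ^ j - ((r : ℂ) - 1) ^ j) * (∑ t ∈ Finset.range (f.natDegree - r + 1),
    ((factorizationType f).map fun d => 1 - (X : ℂ[X]) ^ d).prod.coeff t) * h

theorem natDegree_prod_one_sub_X_pow_le (τ : Multiset ℕ) :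
    (τ.map fun d => 1 - (X : ℂ[X]) ^ d).prod.natDegree ≤ τ.sum := by
  induction τ using Multiset.induction_on with
  | empty => simp
  | cons a τ ih =>
    rw [Multiset.map_cons, Multiset.prod_cons, Multiset.sum_cons]
    refine natDegree_mul_le_of_le ?_ ih
    exact (natDegree_sub_le _ _).trans (by simp)

theorem sum_coeff_mul_sub (G : ℂ[X]) {n : ℕ} (hG : G.natDegree ≤ n) :
    ∑ t ∈ Finset.range (n + 1), G.coeff t * ((n - t : ℕ) : ℂ) =
      n * G.eval 1 - G.derivative.eval 1 := by
  rw [eval_eq_sum_range' (Nat.lt_succ_of_le hG), derivative_eval,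
    sum_over_range' G (by simp) (n + 1) (Nat.lt_succ_of_le hG), Finset.mul_sum,
    ← Finset.sum_sub_distrib]
  refine Finset.sum_congr rfl fun t ht => ?_
  rw [Nat.cast_sub (Nat.lt_succ_iff.1 (Finset.mem_range.1 ht))]
  simp
  ring

/-- The right side is `n * G(1) - G'(1)`, and each factor `1 - X ^ d` of `G` vanishes at `1`. One
factor gives `d`; two or more give a multiple root and hence `0`; for `f = 1`, `G = 1` and `n = 0`.
-/
theorem vonMangoldt_eq_higherVonMangoldt_one {f : F[X]} (hf : f.Monic) (hsq : Squarefree f) :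
    vonMangoldt f = higherVonMangoldt 1 f := by
  classical
  have hsum := sum_factorizationType hf
  have hprod := prod_normalizedFactors_of_monic hf
  rw [higherVonMangoldt_eq hf hsq]
  simp only [pow_one]
  rw [sum_coeff_mul_sub _ ((natDegree_prod_one_sub_X_pow_le _).trans_eq hsum)]
  by_cases hirr : Irreducible f
  · have h1 : factorizationType f = {f.natDegree} := by
      rw [factorizationType, normalizedFactors_irreducible hirr, hf.normalize_eq_self]
      simp
    rw [h1]
    have h2 := vonMangoldt_pow f hf hirr 1 le_rfl
    rw [pow_one] at h2
    simp [h2, derivative_X_pow]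
  · have h1 : vonMangoldt f = 0 := by
      refine dif_neg ?_
      rintro ⟨P, hPm, hP, k, hk, rfl⟩
      obtain rfl | hk : k = 1 ∨ 2 ≤ k := by omega
      · exact hirr (by rwa [pow_one])
      · refine hP.not_isUnit (hsq P ?_)
        rw [← sq]
        exact pow_dvd_pow P hk
    rw [h1, factorizationType]
    have hN : ∀ P ∈ normalizedFactors f, Irreducible P := fun P hP => irreducible_of_normalized_factor P hP
    rcases (normalizedFactors f).empty_or_exists_mem with hc | ⟨P, hP⟩
    · rw [hc, Multiset.prod_zero] at hprod
      simp [← hprod]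
    · obtain ⟨N, hc⟩ := Multiset.exists_cons_of_mem hP
      rcases N.empty_or_exists_mem with rfl | ⟨Q, hQ⟩
      · rw [hc, Multiset.cons_zero, Multiset.prod_singleton] at hprod
        exact absurd (hprod ▸ hN P hP) hirr
      · obtain ⟨N, rfl⟩ := Multiset.exists_cons_of_mem hQ
        simp [hc]

end DivisorSums

end

theorem SupportedOnSquareful.exists_of_eq {F : Type*} [Field F] {u v : F[X] → ℂ}
    (h : ∀ f : F[X], f.Monic → Squarefree f → u f = v f) :
    ∃ b : F[X] → ℂ, SupportedOnSquareful b ∧ ∀ f, u f = v f + b f :=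
  ⟨fun f => u f - v f, fun f hf hsq => sub_eq_zero.2 (h f hf hsq), fun f => by ring⟩

theorem mainTheorem12 {F : Type*} [Field F] [Finite F] :
    (∀ r s : ℕ, 1 ≤ r → ∃ b : F[X] → ℂ, SupportedOnSquareful b ∧
      ∀ f : F[X], f.Monic → f.natDegree = r + s →
        truncMoebiusSum s f = (-1) ^ s * polyChar (hook r s) f + b f) ∧
    (∀ j : ℕ, 1 ≤ j → ∃ b : F[X] → ℂ, SupportedOnSquareful b ∧
      ∀ (n : ℕ) (f : F[X]), f.Monic → f.natDegree = n →
        higherVonMangoldt j f =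
          ∑ r ∈ Finset.Icc 1 n,
            (-1) ^ (n - r) * ((r : ℂ) ^ j - ((r : ℂ) - 1) ^ j) * polyChar (hook r (n - r)) f
          + b f) ∧
    (∃ b : F[X] → ℂ, SupportedOnSquareful b ∧
      ∀ (n : ℕ) (f : F[X]), f.Monic → f.natDegree = n →
        vonMangoldt f =
          ∑ r ∈ Finset.Icc 1 n, (-1) ^ (n - r) * polyChar (hook r (n - r)) f + b f) := by
  refine ⟨fun r s hr => ?_, fun j hj => ?_, ?_⟩
  · classical
    obtain ⟨b, hb, h⟩ := SupportedOnSquareful.exists_of_eq (F := F)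
      -- The cutoff by degree is needed because `b` must vanish at squarefree polynomials of every
      -- degree, while the identity concerns degree `r + s` only.
      (u := fun f => if f.natDegree = r + s then truncMoebiusSum s f else 0)
      (v := fun f => if f.natDegree = r + s then (-1) ^ s * polyChar (hook r s) f else 0) (by
        intro f hf hsq
        split_ifs with hn
        · rw [truncMoebiusSum_eq hf hsq (by omega), polyChar_hook hf hsq hr hn, ← mul_assoc,
            ← mul_pow]
          simp
        · rfl)
    refine ⟨b, hb, fun f _ hn => ?_⟩
    have := h f
    simpa only [if_pos hn] using this
  · obtain ⟨b, hb, h⟩ := SupportedOnSquareful.exists_of_eq (F := F)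
      fun f hf hsq => higherVonMangoldt_eq_sum_polyChar hf hsq hj
    refine ⟨b, hb, ?_⟩
    rintro _ f - rfl
    exact h f
  · obtain ⟨b, hb, h⟩ := SupportedOnSquareful.exists_of_eq (F := F)
      (u := vonMangoldt) (v := fun f => ∑ r ∈ Finset.Icc 1 f.natDegree,
        (-1) ^ (f.natDegree - r) * polyChar (hook r (f.natDegree - r)) f) (by
        intro f hf hsq
        -- For `j = 1` the weights `r - (r - 1)` are all `1`.
        rw [vonMangoldt_eq_higherVonMangoldt_one hf hsq,
          higherVonMangoldt_eq_sum_polyChar hf hsq le_rfl]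
        refine Finset.sum_congr rfl fun r _ => ?_
        ring)
    refine ⟨b, hb, ?_⟩
    rintro _ f - rfl
    exact h f
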